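/- Let $[Z]^{<\omega}$ denote the set of finite subsets of $Z$. For a finite family $\mathcal F$ of finite sets, $\mathfrak{fr}(\mathcal F)$ is the least natural number $n\ge 0$ such that for every function $S:[\aleph_n]^{<\omega}\to[\aleph_n]^{<\omega}$ there exist $Y\subset\aleph_n$ and a bijection $u:\bigcup\mathcal F\to Y$ with $S(u(A))\cap Y\subset u(A)$ for all $A\in\mathcal F$. For a natural number $n\ge 0$, a nested-orders family of degree $n$ on a set $X$ is a family $\mathfrak S$ of finite sequences of elements of $X$, of length at most $n+2$, such that 1. $(t)\in\mathfrak S$ for all $t\in X$; 2. the terms of each sequence in $\mathfrak S$ are pairwise distinct; 3. if $(t_1,\dots,t_k)\in\mathfrak S$, then $(t_1,\dots,t_{k-1})\in\mathfrak S$ (for $k\ge 1$) and $(t_1,\dots,t_{k-2},t_k)\in\mathfrak S$ (for $k\ge 2$); 4. if $(t_1,\dots,t_k,s,t)\in\mathfrak S$ and $(t_1,\dots,t_k,t,u)\in\mathfrak S$, then $(t_1,\dots,t_k,s,u)\in\mathfrak S$ (for $k\ge 0$); 5. if $0\le k\le n$, $(t_1,\dots,t_k,t)\in\mathfrak S$,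 $(t_1,\dots,t_k,s)\in\mathfrak S$ and $t\ne s$, then $(t_1,\dots,t_k,t,s)\in\mathfrak S$ or $(t_1,\dots,t_k,s,t)\in\mathfrak S$. Put $$\mathcal F_{\mathfrak S,n}=\{A\subset X:\ \text{if } (t_1,\dots,t_{n+2})\in\mathfrak S \text{ and } t_1,\dots,t_{n+1}\in A,\ \text{then } t_{n+2}\in A\}.$$ For a family $\mathcal F$ of subsets of a finite set $X$, $\mathfrak{no}(\mathcal F)$ is the least natural number $n\ge 0$ for which there is a nested-orders family $\mathfrak S$ of degree $n$ on $X$ with $\mathcal F\subset\mathcal F_{\mathfrak S,n}$. A family $\mathcal F$ of subsets of $X$ contains a cycle if there are $k\ge 3$ and a set $A=\{x_1,\dots,x_k\}\subset X$ of $k$ distinct elements such that $\{x_1,x_2\},\{x_2,x_3\},\dots,\{x_{k-1},x_k\},\{x_k,x_1\}$ all belong to $\{B\cap A: B\in\mathcal F\}$. The family is closed under intersections if the intersection of every subfamily belongs to $\mathcal F$, the intersection of the empty subfamily being $X$ (so $X\in\mathcal F$). **Theorem.** Let $\mathcal F$ be a family of subsets of $X=\{1,2,3,4\}$. Then $\mathfrak{fr}(\mathcal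 F)$ and $\mathfrak{no}(\mathcal F)$ exist (both minima are attained) and $\mathfrak{fr}(\mathcal F)=\mathfrak{no}(\mathcal F)$. If, moreover, $\mathcal F$ is closed under intersections, then 1. $\mathfrak{fr}(\mathcal F)=\mathfrak{no}(\mathcal F)=0$ if and only if $\mathcal F$ is linearly ordered by inclusion; 2. $\mathfrak{fr}(\mathcal F)=\mathfrak{no}(\mathcal F)=3$ if and only if $\mathcal F$ consists of all subsets of $X$; 3. $\mathfrak{fr}(\mathcal F)=\mathfrak{no}(\mathcal F)=2$ if and only if $\mathcal F$ does not consist of all subsets of $X$ and $\mathcal F$ contains a cycle; 4. $\mathfrak{fr}(\mathcal F)=\mathfrak{no}(\mathcal F)=1$ in the remaining cases, i.e. if and only if $\mathcal F$ is not linearly ordered by inclusion, does not consist of all subsets of $X$, and contains no cycle. -/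

import Mathlib

open scoped Ordinal

/-- `FreeAt F n`: for every function `S` from finite subsets of `ω_n` to finite subsets of `ω_n`
there are `Y ⊆ ω_n` and a bijection `u : ⋃ F → Y` with `S (u A) ∩ Y ⊆ u A` for all `A ∈ F`.
The map `u` is total for convenience; only its values on `⋃ F` are used. -/
def FreeAt {X : Type*} [DecidableEq X] (F : Finset (Finset X)) (n : ℕ) : Prop :=
  ∀ S : Finset (ω_ (n : Ordinal.{0})).ToType → Finset (ω_ (n : Ordinal.{0})).ToType,
    ∃ (Y : Finset (ω_ (n : Ordinal.{0})).ToType) (u : X → (ω_ (n : Ordinal.{0})).ToType),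
      Set.BijOn u (F.sup id : Finset X) Y ∧
        ∀ A ∈ F, S (A.image u) ∩ Y ⊆ A.image u

/-- The index `𝔣𝔯(F)`: the least `n` such that `FreeAt F n`. -/
noncomputable def fr {X : Type*} [DecidableEq X] (F : Finset (Finset X)) : ℕ :=
  sInf {n | FreeAt F n}

/-- `𝔖` is a nested-orders family of degree `n` on `X`: a family of finite sequences of length
at most `n + 2` subject to the following conditions. -/
structure IsNestedOrders {X : Type*} (n : ℕ) (𝔖 : Set (List X)) : Prop where
  length_le : ∀ l ∈ 𝔖, l.length ≤ n + 2
  singleton_mem : ∀ t, [t] ∈ 𝔖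
  nodup : ∀ l ∈ 𝔖, l.Nodup
  init_mem : ∀ l t, l ++ [t] ∈ 𝔖 → l ∈ 𝔖
  skip_mem : ∀ l s t, l ++ [s, t] ∈ 𝔖 → l ++ [t] ∈ 𝔖
  trans : ∀ l s t u, l ++ [s, t] ∈ 𝔖 → l ++ [t, u] ∈ 𝔖 → l ++ [s, u] ∈ 𝔖
  total : ∀ l s t, l.length ≤ n → l ++ [t] ∈ 𝔖 → l ++ [s] ∈ 𝔖 → t ≠ s →
    l ++ [t, s] ∈ 𝔖 ∨ l ++ [s, t] ∈ 𝔖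

/-- The sets `A ⊆ X` such that whenever `(t₁, …, tₙ₊₁, tₙ₊₂) ∈ 𝔖` and `t₁, …, tₙ₊₁ ∈ A`,
also `tₙ₊₂ ∈ A`. -/
def nestedFamily {X : Type*} (𝔖 : Set (List X)) (n : ℕ) : Set (Finset X) :=
  {A | ∀ (l : List X) (t : X), l.length = n + 1 → l ++ [t] ∈ 𝔖 → (∀ s ∈ l, s ∈ A) → t ∈ A}

/-- `NestedAt F n`: `F` is contained in the family of sets given by some nested-orders family of
degree `n`. -/
def NestedAt {X : Type*} (F : Finset (Finset X)) (n : ℕ) : Prop :=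
  ∃ 𝔖 : Set (List X), IsNestedOrders n 𝔖 ∧ ∀ A ∈ F, A ∈ nestedFamily 𝔖 n

/-- The index `𝔫𝔬(F)`: the least `n` such that `NestedAt F n`. -/
noncomputable def no {X : Type*} (F : Finset (Finset X)) : ℕ :=
  sInf {n | NestedAt F n}

/-- The restriction `{B ∩ A : B ∈ F}` of the family `F` to the set `A`. -/
def restrictFamily {X : Type*} [DecidableEq X] (F : Finset (Finset X)) (A : Finset X) :
    Finset (Finset X) :=
  F.image (fun B => B ∩ A)

/-- `F` contains a cycle: there is a set `A = {x₁, …, xₖ}` with `k ≥ 3` distinct elements such that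
`{x₁, x₂}, …, {xₖ₋₁, xₖ}, {xₖ, x₁}` all belong to the restriction of `F` to `A`.
Here `k = m + 3`, and `i + 1` is the cyclic successor in `Fin (m + 3)`. -/
def ContainsCycle {X : Type*} [DecidableEq X] (F : Finset (Finset X)) : Prop :=
  ∃ (m : ℕ) (x : Fin (m + 3) → X), Function.Injective x ∧
    ∀ i, {x i, x (i + 1)} ∈ restrictFamily F (Finset.univ.image x)

/-- `F` is closed under intersections; the intersection of the empty subfamily is the whole `X`. -/
def InterClosed {X : Type*} [Fintype X] [DecidableEq X] (F : Finset (Finset X)) : Prop :=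
  ∀ G ⊆ F, G.inf id ∈ F

/-- `F` is linearly ordered by inclusion. -/
def LinearlyOrdered {X : Type*} (F : Finset (Finset X)) : Prop :=
  ∀ A ∈ F, ∀ B ∈ F, A ⊆ B ∨ B ⊆ A

/-!
The two indices agree on a four-element set because for `n ≤ 3` the conditions `FreeAt F n` and
`NestedAt F n` are equivalent.

From freeness to nested orders (`FreeAt.nestedAt`, valid for every `n`): `ωₙ` carries nested orders of
degree `n` in which the innermost orders have finite initial segments, obtained by repeatedly choosing
well-orders whose initial segments have smaller cardinality (`exists_isNestedOrdersOn`). Hence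
`A ↦ {tₙ₊₂ : (t₁, …, tₙ₊₂) ∈ 𝔖, t₁, …, tₙ₊₁ ∈ A}` is a set mapping with finite values, and a free copy
of `F` for it pulls the nested orders back.

From nested orders to freeness: nested orders on four points impose on `F` closure rules such as "if
`a, b ∈ A` then `c ∈ A`". In degree `0` they say that `F` is contained in a maximal chain. In degree
`1` there are, for a suitable enumeration `a, b, c, d`, the rules `a, b → c`, `a, b → d`, `a, c → d`
and one more rule among `b, c, d`; in degree `2` there is the single rule `a, b, c → d`. For a set
mapping on `ωₙ` a free copy of the family of all sets that obey these rules is then found by choosing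
points in and outside of closed sets of smaller cardinalities: `exists_free_four` for `n = 3`,
`exists_free_except_triple` for `n = 2`, `exists_free_of_pigeonhole` and `exists_free_of_closure`
for `n = 1`.

The values of the index of a family closed under intersections are read off from the rules. A family
obeys the rules of degree `0` exactly if it is linearly ordered. It obeys those of degree `2` exactly
if a coatom is missing, that is, if it does not consist of all sets. Those of degree `1` exclude
cycles; conversely, each triple of a family without cycles obeys a rule, and a finite analysis of these
rules (`exists_hasRule_hasRule`) yields the rules of degree `1`.
-/

open Cardinal

/-! ### Closing sets under set mappings -/

/-- Every set of cardinality at most an infinite `κ` is contained in a set of cardinality at most `κ`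
that is closed under the set mapping `S`. -/
theorem exists_closed {K : Type} (S : Finset K → Finset K) {κ : Cardinal.{0}} (hκ : ℵ₀ ≤ κ)
    {B : Set K} (hB : #B ≤ κ) :
    ∃ M : Set K, B ⊆ M ∧ #M ≤ κ ∧ ∀ s : Finset K, (s : Set K) ⊆ M → (S s : Set K) ⊆ M := by
  classical
  let step : Set K → Set K := fun M => M ∪ ⋃ s : Finset M, (S (s.map (.subtype _)) : Set K)
  have hstep : ∀ M : Set K, #M ≤ κ → #(step M) ≤ κ := by
    intro M hM
    refine (mk_union_le _ _).trans (add_le_of_le hκ hM ?_)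
    refine (mk_iUnion_le _).trans (mul_le_of_le hκ ?_ ?_)
    · rcases finite_or_infinite M with h | h
      · exact (lt_aleph0_of_finite _).le.trans hκ
      · rwa [mk_finset_of_infinite]
    · exact ciSup_le' fun s => (lt_aleph0_of_finite _).le.trans hκ
  let N : ℕ → Set K := fun i => step^[i] B
  have hNs : ∀ i, N (i + 1) = step (N i) := fun i => Function.iterate_succ_apply' _ _ _
  have hN : ∀ i, #(N i) ≤ κ := by
    intro i
    induction i with
    | zero => exact hB
    | succ i ih => rw [hNs]; exact hstep _ ih
  have hmono : Monotone N := by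
    refine monotone_nat_of_le_succ fun i => ?_
    rw [hNs]
    exact Set.subset_union_left
  refine ⟨⋃ i, N i, Set.subset_iUnion N 0, ?_, fun s hs => ?_⟩
  · refine (mk_iUnion_le _).trans (mul_le_of_le hκ ?_ ?_)
    · simpa using hκ
    · exact ciSup_le' hN
  · obtain ⟨i, hi⟩ : ∃ i, (s : Set K) ⊆ N i :=
      hmono.directed_le.exists_mem_subset_of_finset_subset_biUnion hs
    intro y hy
    refine Set.mem_iUnion.2 ⟨i + 1, ?_⟩
    rw [hNs]
    refine Or.inr (Set.mem_iUnion.2 ⟨s.subtype (· ∈ N i), ?_⟩)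
    rwa [Finset.subtype_map_of_mem (p := (· ∈ N i)) (fun x hx => hi hx)]

theorem exists_notMem_of_mk_lt {K : Type} {A B : Set K} (h : #B < #A) : ∃ x ∈ A, x ∉ B := by
  by_contra! hc
  exact (mk_le_mk_of_subset hc).not_gt h

theorem exists_subset_mk_eq {K : Type} {A : Set K} {κ : Cardinal.{0}} (h : κ ≤ #A) :
    ∃ B ⊆ A, #B = κ := le_mk_iff_exists_subset.1 h

theorem exists_mem_notMem_finset {K : Type} {A : Set K} (hA : ℵ₀ ≤ #A) (s : Finset K) :
    ∃ x ∈ A, x ∉ s := by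
  have : A.Infinite := Set.infinite_coe_iff.1 (infinite_iff.2 hA)
  exact this.exists_notMem_finset s

/-! ### Free quadruples -/

/-- Kuratowski's free set theorem for four points. The point `a` lies outside a closed set of
cardinality `ℵ₂`; `b` lies in that set, outside a smaller set closed under `s ↦ S (insert a s)`; and
so on down to `d`, which only has to avoid a finite set. -/
theorem exists_free_four {K : Type} [DecidableEq K] (S : Finset K → Finset K) (hK : ℵ_ 3 ≤ #K) :
    ∃ a b c d : K, a ∉ S {b, c, d} ∧ b ∉ S {a, c, d} ∧ c ∉ S {a, b, d} ∧ d ∉ S {a, b, c} := by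
  have l01 : ℵ₀ < ℵ_ 1 := by simp
  have l12 : ℵ_ 1 < ℵ_ 2 := aleph_lt_aleph.2 (by norm_num)
  have l23 : ℵ_ 2 < ℵ_ 3 := aleph_lt_aleph.2 (by exact_mod_cast (by norm_num : 2 < 3))
  obtain ⟨B₃, -, hB₃⟩ := exists_subset_mk_eq (A := (Set.univ : Set K)) (κ := ℵ_ 2)
    (by rw [mk_univ]; exact l23.le.trans hK)
  obtain ⟨M₃, hBM₃, hM₃, cl₃⟩ := exists_closed S (aleph0_le_aleph 2) hB₃.le
  obtain ⟨a, -, ha⟩ := exists_notMem_of_mk_lt (A := (Set.univ : Set K)) (B := M₃)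
    (by rw [mk_univ]; exact hM₃.trans_lt (l23.trans_le hK))
  obtain ⟨B₂, hB₂₃, hB₂⟩ := exists_subset_mk_eq (l12.le.trans hB₃.ge)
  obtain ⟨M₂, hBM₂, hM₂, cl₂⟩ := exists_closed (fun s => S (insert a s)) (aleph0_le_aleph 1) hB₂.le
  obtain ⟨b, hb, hbM⟩ := exists_notMem_of_mk_lt (hM₂.trans_lt (l12.trans_eq hB₃.symm))
  obtain ⟨B₁, hB₁₂, hB₁⟩ := exists_subset_mk_eq (l01.le.trans hB₂.ge)
  obtain ⟨M₁, hBM₁, hM₁, cl₁⟩ :=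
    exists_closed (fun s => S (insert a (insert b s))) le_rfl hB₁.le
  obtain ⟨c, hc, hcM⟩ := exists_notMem_of_mk_lt (hM₁.trans_lt (l01.trans_eq hB₂.symm))
  obtain ⟨d, hd, hdS⟩ := exists_mem_notMem_finset hB₁.ge (S {a, b, c})
  refine ⟨a, b, c, d, fun h => ha (cl₃ {b, c, d} ?_ h), fun h => hbM (cl₂ {c, d} ?_ h),
    fun h => hcM (cl₁ {d} ?_ h), hdS⟩
  · have := hBM₃ hb; have := hBM₃ (hB₂₃ hc); have := hBM₃ (hB₂₃ (hB₁₂ hd))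
    simp_all [Set.insert_subset_iff]
  · have := hBM₂ hc; have := hBM₂ (hB₁₂ hd)
    simp_all [Set.insert_subset_iff]
  · have := hBM₁ hd
    simp_all

/-- On `ω₂` four points can be found for which all subsets except possibly `{a, b, c}` are free.

The points `b` and `c` come from a closed set `W` of cardinality `ℵ₁`, while `d` comes from an
uncountable set `D` disjoint from `W`, and `a` lies above both. Thus `d ∉ S {b, c}` although `b` is
chosen outside a countable set closed under `s ↦ S (insert a s)` that contains all candidates for `c`
and `d`; the candidates for `d` lie outside such a closed set that contains those for `c`. -/
theorem exists_free_except_triple {K : Type} [DecidableEq K] (S : Finset K → Finset K)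
    (hK : ℵ_ 2 ≤ #K) :
    ∃ a b c d : K, d ∉ S {a, b} ∧ d ∉ S {a, c} ∧ d ∉ S {b, c} ∧ c ∉ S {a, b, d} ∧
      b ∉ S {a, c, d} ∧ a ∉ S {b, c, d} := by
  have l01 : ℵ₀ < ℵ_ 1 := by simp
  have l12 : ℵ_ 1 < ℵ_ 2 := aleph_lt_aleph.2 (by norm_num)
  have inf1 := aleph0_le_aleph 1
  obtain ⟨B, -, hB⟩ := exists_subset_mk_eq (A := (Set.univ : Set K)) (κ := ℵ_ 1)
    (by rw [mk_univ]; exact l12.le.trans hK)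
  obtain ⟨W, hBW, hW, clW⟩ := exists_closed S inf1 hB.le
  obtain ⟨C, hCB, hC⟩ := exists_subset_mk_eq (l01.le.trans hB.ge)
  have hWc : ℵ_ 1 ≤ #(Wᶜ : Set K) := by
    by_contra! h
    have := mk_sum_compl W
    have h2 : #K ≤ ℵ_ 1 := this ▸ add_le_of_le inf1 hW h.le
    exact (l12.trans_le hK).not_ge h2
  obtain ⟨D, hDW, hD⟩ := exists_subset_mk_eq hWc
  obtain ⟨W₂, hBW₂, hW₂, clW₂⟩ := exists_closed S inf1
    ((mk_union_le W D).trans (add_le_of_le inf1 hW hD.le))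
  obtain ⟨a, -, ha⟩ := exists_notMem_of_mk_lt (A := (Set.univ : Set K)) (B := W₂)
    (by rw [mk_univ]; exact hW₂.trans_lt (l12.trans_le hK))
  obtain ⟨N, hCN, hN, clN⟩ := exists_closed (fun s => S (insert a s)) le_rfl hC.le
  have hDN : ℵ₀ ≤ #(D \ N : Set K) := by
    by_contra! h
    have h1 : #D ≤ #(D \ N ∪ N : Set K) := mk_le_mk_of_subset fun x hx => by
      by_cases hxN : x ∈ N <;> simp [hx, hxN]
    have h2 : #D ≤ ℵ₀ := h1.trans ((mk_union_le _ _).trans (add_le_of_le le_rfl h.le hN))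
    exact (l01.trans_eq hD.symm).not_ge h2
  obtain ⟨D', hD'D, hD'⟩ := exists_subset_mk_eq hDN
  obtain ⟨N₂, hCN₂, hN₂, clN₂⟩ := exists_closed (fun s => S (insert a s)) le_rfl
    ((mk_union_le C D').trans (add_le_of_le le_rfl hC.le hD'.le))
  obtain ⟨b, hb, hbN⟩ := exists_notMem_of_mk_lt (hN₂.trans_lt (l01.trans_eq hB.symm))
  obtain ⟨d, hd, hdS⟩ := exists_mem_notMem_finset hD'.ge (S {a, b})
  obtain ⟨c, hc, hcS⟩ := exists_mem_notMem_finset hC.ge (S {a, b, d})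
  have hbW := hBW hb
  have hcW := hBW (hCB hc)
  have hdD := (hD'D hd).1
  refine ⟨a, b, c, d, hdS, fun h => (hD'D hd).2 (clN {c} ?_ h),
    fun h => hDW hdD (clW {b, c} ?_ h), hcS, fun h => hbN (clN₂ {c, d} ?_ h),
    fun h => ha (clW₂ {b, c, d} ?_ h)⟩
  · simpa using hCN hc
  · simp [Set.insert_subset_iff, hbW, hcW]
  · simp [Set.insert_subset_iff, hCN₂ (Or.inl hc), hCN₂ (Or.inr hd)]
  · simp [Set.insert_subset_iff, hBW₂ (Or.inl hbW), hBW₂ (Or.inl hcW), hBW₂ (Or.inr hdD)]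

/-- If uncountably many points `t` are given, then all but finitely many points of a countable set
`C` are avoided by uncountably many of the finite sets `f t`: a point `t` that belongs to none of
infinitely many countable exceptional sets would have infinitely many elements in `f t`. -/
theorem finite_setOf_countable_avoiding {K : Type} {Z C : Set K} (hZ : ¬ Z.Countable) (hC : C.Countable)
    (f : K → Finset K) : {m ∈ C | {t ∈ Z | m ∉ f t}.Countable}.Finite := by
  by_contra hI
  set I := {m ∈ C | {t ∈ Z | m ∉ f t}.Countable} with hIdef
  have hIc : I.Countable := hC.mono fun m hm => hm.1
  have hU : (⋃ m ∈ I, {t ∈ Z | m ∉ f t}).Countable := hIc.biUnion fun m hm => hm.2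
  obtain ⟨t, htZ, ht⟩ : ∃ t ∈ Z, t ∉ ⋃ m ∈ I, {t ∈ Z | m ∉ f t} := by
    by_contra! hc
    exact hZ (hU.mono hc)
  refine hI ((f t).finite_toSet.subset fun m hm => ?_)
  by_contra hmt
  exact ht (Set.mem_biUnion hm ⟨htZ, hmt⟩)

theorem exists_countable_infinite_subset {K : Type} {Z : Set K} (hZ : Z.Infinite) :
    ∃ C ⊆ Z, C.Countable ∧ C.Infinite := by
  obtain ⟨C, hC, hC'⟩ := exists_subset_mk_eq (A := Z) (κ := ℵ₀)
    (infinite_iff.1 (Set.infinite_coe_iff.2 hZ))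
  exact ⟨C, hC, le_aleph0_iff_set_countable.1 hC'.le,
    Set.infinite_coe_iff.1 (infinite_iff.2 hC'.ge)⟩

theorem exists_mem_avoiding_uncountable {K : Type} {Z : Set K} (hZ : ¬ Z.Countable) (f : K → Finset K) :
    ∃ m ∈ Z, ¬ {t ∈ Z | m ∉ f t}.Countable := by
  obtain ⟨C, hCZ, hC, hCi⟩ :=
    exists_countable_infinite_subset (Z := Z) fun h => hZ h.countable
  obtain ⟨m, hm, hm'⟩ := (hCi.sdiff (finite_setOf_countable_avoiding hZ hC f)).nonempty
  exact ⟨m, hCZ hm, fun h => hm' ⟨hm, h⟩⟩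

/-- Here `d`, `c`, `b` are chosen in this order so that each is avoided for uncountably many choices of
the next points. -/
theorem exists_free_of_pigeonhole {K : Type} [DecidableEq K] (S : Finset K → Finset K)
    (hK : Uncountable K) :
    ∃ a b c d : K, d ∉ S {a} ∧ d ∉ S {b} ∧ d ∉ S {c} ∧ c ∉ S {a, d} ∧ c ∉ S {b, d} ∧
      b ∉ S {a, c, d} ∧ a ∉ S {b, c, d} := by
  have hu : ¬ (Set.univ : Set K).Countable := by
    rw [Set.countable_univ_iff, not_countable_iff]; exact hK
  obtain ⟨d, -, hd⟩ := exists_mem_avoiding_uncountable hu fun t => S {t}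
  obtain ⟨c, hc, hc'⟩ := exists_mem_avoiding_uncountable hd fun t => S {t, d}
  obtain ⟨b, hb, hb'⟩ := exists_mem_avoiding_uncountable hc' fun t => S {t, c, d}
  obtain ⟨a, ha, ha'⟩ :=
    Set.Infinite.exists_notMem_finset (fun h => hb' h.countable) (S {b, c, d})
  exact ⟨a, b, c, d, ha.1.1.2, hb.1.2, hc.2, ha.1.2, hb.2, ha.2, ha'⟩

/-- Here `x` is taken from a countable set, `y` from one of the sets `D x` of points `t` with
`x ∉ S {t}`, the point `d` outside a countable closed set containing all these, and `a` outside a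
larger one. The choice is made in the order `a, d, x, y`; this is possible since all but finitely many
`x` have an infinite `D x`. -/
theorem exists_free_of_closure {K : Type} [DecidableEq K] (S : Finset K → Finset K)
    (hK : Uncountable K) :
    ∃ a d x y : K, x ∉ S {a, d} ∧ y ∉ S {a, x, d} ∧ x ∉ S {y} ∧ d ∉ S {a} ∧ d ∉ S {x, y} ∧
      a ∉ S {x, y, d} := by
  have hu : ¬ (Set.univ : Set K).Countable := by
    rw [Set.countable_univ_iff, not_countable_iff]; exact hK
  have exists_notMem : ∀ M : Set K, M.Countable → (Mᶜ : Set K).Infinite := fun M hM h =>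
    hu (by simpa using hM.union h.countable)
  have closed : ∀ B : Set K, B.Countable → ∃ M : Set K, B ⊆ M ∧ M.Countable ∧
      ∀ s : Finset K, (s : Set K) ⊆ M → (S s : Set K) ⊆ M := fun B hB => by
    obtain ⟨M, h1, h2, h3⟩ := exists_closed S le_rfl (le_aleph0_iff_set_countable.2 hB)
    exact ⟨M, h1, le_aleph0_iff_set_countable.1 h2, h3⟩
  obtain ⟨C, -, hC, hCi⟩ :=
    exists_countable_infinite_subset (Z := (Set.univ : Set K)) fun h => hu h.countable
  have hfin := finite_setOf_countable_avoiding hu hC fun t => S {t}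
  have hD : ∀ m : K, ∃ D : Set K, D.Countable ∧ (∀ t ∈ D, m ∉ S {t}) ∧
      (¬ {t ∈ Set.univ | m ∉ S {t}}.Countable → D.Infinite) := fun m => by
    by_cases h : {t ∈ Set.univ | m ∉ S {t}}.Countable
    · exact ⟨∅, Set.countable_empty, by simp, fun h' => absurd h h'⟩
    · obtain ⟨D, hDZ, hD, hDi⟩ := exists_countable_infinite_subset
        (Z := {t ∈ Set.univ | m ∉ S {t}}) fun h' => h h'.countable
      exact ⟨D, hD, fun t ht => (hDZ ht).2, fun _ => hDi⟩
  choose D hD hDS hDi using hD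
  obtain ⟨M₁, hM₁, hM₁c, cl₁⟩ := closed (C ∪ ⋃ m ∈ C, D m) (hC.union (hC.biUnion fun m _ => hD m))
  obtain ⟨E, hE, hEc, hEi⟩ := exists_countable_infinite_subset (exists_notMem M₁ hM₁c)
  obtain ⟨M₂, hM₂, hM₂c, cl₂⟩ := closed (M₁ ∪ E) (hM₁c.union hEc)
  obtain ⟨a, ha⟩ := (exists_notMem M₂ hM₂c).nonempty
  obtain ⟨d, hd, hdS⟩ := hEi.exists_notMem_finset (S {a})
  obtain ⟨x, hx, hxS⟩ := (hCi.sdiff hfin).exists_notMem_finset (S {a, d})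
  obtain ⟨y, hy, hyS⟩ := (hDi x fun h => hx.2 ⟨hx.1, h⟩).exists_notMem_finset (S {a, x, d})
  have hxM : x ∈ M₁ := hM₁ (Or.inl hx.1)
  have hyM : y ∈ M₁ := hM₁ (Or.inr (Set.mem_biUnion hx.1 hy))
  refine ⟨a, d, x, y, hxS, hyS, hDS x y hy, hdS, fun h => hE hd (cl₁ {x, y} ?_ h),
    fun h => ha (cl₂ {x, y, d} ?_ h)⟩
  · simp [Set.insert_subset_iff, hxM, hyM]
  · simp [Set.insert_subset_iff, hM₂ (Or.inl hxM), hM₂ (Or.inl hyM), hM₂ (Or.inr hd)]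

/-! ### Nested orders on sets of bounded cardinality -/

/-- A nested-orders family of degree `m - 1` on the elements of `Z` in which every sequence of the
greatest but one length has only finitely many continuations. Shifting the degree by one makes the
case `m = 0`, where `Z` is finite and the family consists of the sequences of length at most one,
available as the start of the recursion. -/
structure IsNestedOrdersOn {K : Type} (Z : Set K) (m : ℕ) (𝔖 : Set (List K)) : Prop where
  length_le : ∀ l ∈ 𝔖, l.length ≤ m + 1
  nil_mem : [] ∈ 𝔖
  singleton_mem : ∀ t, [t] ∈ 𝔖 ↔ t ∈ Z
  subset : ∀ l ∈ 𝔖, ∀ t ∈ l, t ∈ Z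
  nodup : ∀ l ∈ 𝔖, l.Nodup
  init_mem : ∀ l t, l ++ [t] ∈ 𝔖 → l ∈ 𝔖
  skip_mem : ∀ l s t, l ++ [s, t] ∈ 𝔖 → l ++ [t] ∈ 𝔖
  trans : ∀ l s t u, l ++ [s, t] ∈ 𝔖 → l ++ [t, u] ∈ 𝔖 → l ++ [s, u] ∈ 𝔖
  total : ∀ l s t, l.length < m → l ++ [t] ∈ 𝔖 → l ++ [s] ∈ 𝔖 → t ≠ s →
    l ++ [t, s] ∈ 𝔖 ∨ l ++ [s, t] ∈ 𝔖
  finite : ∀ l, l.length = m → {t | l ++ [t] ∈ 𝔖}.Finite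

/-- A set of cardinality less than `ℵₘ` is well-ordered with initial segments of cardinality less
than `ℵₘ₋₁`, and these carry nested orders of the next lower degree. -/
theorem exists_isNestedOrdersOn {K : Type} (m : ℕ) :
    ∀ Z : Set K, #Z < ℵ_ (m : Ordinal) → ∃ 𝔖, IsNestedOrdersOn Z m 𝔖 := by
  induction m with
  | zero =>
    intro Z hZ
    have hZf : Z.Finite := by simpa [lt_aleph0_iff_set_finite] using hZ
    refine ⟨{l | l = [] ∨ ∃ t ∈ Z, l = [t]}, ?_, ?_, ?_, ?_, ?_, ?_, ?_, ?_, ?_, ?_⟩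
    · rintro l (rfl | ⟨t, -, rfl⟩) <;> simp
    · simp
    · simp
    · rintro l (rfl | ⟨t, ht, rfl⟩) <;> simp_all
    · rintro l (rfl | ⟨t, ht, rfl⟩) <;> simp
    · rintro l t (h | ⟨s, -, h⟩)
      · simp at h
      · exact Or.inl (by simpa using congrArg List.dropLast h)
    · rintro l s t (h | ⟨s, -, h⟩)
      · simp at h
      · simpa using congrArg List.length h
    · rintro l s t u (h | ⟨s, -, h⟩)
      · simp at h
      · simpa using congrArg List.length h
    · intro l s t h
      simp at h
    · intro l hl
      obtain rfl := List.length_eq_zero_iff.1 hl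
      simpa using hZf
  | succ m ih =>
    intro Z hZ
    have hZ' : #Z ≤ ℵ_ (m : Ordinal) := by
      rw [Nat.cast_succ, ← succ_aleph] at hZ
      exact Order.lt_succ_iff.1 hZ
    obtain ⟨_, _, hord⟩ := exists_ord_eq_type_lt Z
    have hseg : ∀ x : Z, ∃ 𝔖, IsNestedOrdersOn (Subtype.val '' Set.Iio x) m 𝔖 := fun x =>
      ih _ (mk_image_le.trans_lt ((mk_Iio_lt x hord).trans_le hZ'))
    choose 𝔖 h𝔖 using hseg
    let 𝔗 : Set (List K) := {l | l = [] ∨ ∃ (x : Z) (l' : List K), l = x.1 :: l' ∧ l' ∈ 𝔖 x}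
    have nil : ([] : List K) ∈ 𝔗 := Or.inl rfl
    have cons : ∀ (x : K) (l : List K), x :: l ∈ 𝔗 ↔ ∃ h : x ∈ Z, l ∈ 𝔖 ⟨x, h⟩ := by
      intro x l
      constructor
      · rintro (h | ⟨y, l', h, hl⟩)
        · simp at h
        · obtain ⟨rfl, rfl⟩ := List.cons.inj h
          exact ⟨y.2, hl⟩
      · rintro ⟨h, hl⟩
        exact Or.inr ⟨⟨x, h⟩, l, rfl, hl⟩
    have single : ∀ t, [t] ∈ 𝔗 ↔ t ∈ Z := fun t => by
      rw [cons]
      exact ⟨fun ⟨h, _⟩ => h, fun h => ⟨h, (h𝔖 _).nil_mem⟩⟩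
    have pair : ∀ s t, [s, t] ∈ 𝔗 ↔ ∃ (hs : s ∈ Z) (ht : t ∈ Z), (⟨t, ht⟩ : Z) < ⟨s, hs⟩ := by
      intro s t
      rw [cons]
      refine exists_congr fun hs => ?_
      rw [(h𝔖 _).singleton_mem]
      constructor
      · rintro ⟨y, hy, rfl⟩
        exact ⟨y.2, hy⟩
      · rintro ⟨ht, h⟩
        exact ⟨_, h, rfl⟩
    refine ⟨𝔗, ?_, nil, single, ?_, ?_, ?_, ?_, ?_, ?_, ?_⟩
    · rintro l (rfl | ⟨x, l, rfl, hl⟩)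
      · simp
      · simpa using (h𝔖 x).length_le l hl
    · rintro l (rfl | ⟨x, l, rfl, hl⟩) t ht
      · simp at ht
      · rcases List.mem_cons.1 ht with rfl | ht
        · exact x.2
        · obtain ⟨y, -, rfl⟩ := (h𝔖 x).subset l hl t ht
          exact y.2
    · rintro l (rfl | ⟨x, l, rfl, hl⟩)
      · simp
      · refine List.nodup_cons.2 ⟨fun hx => ?_, (h𝔖 x).nodup l hl⟩
        obtain ⟨y, hy, hyx⟩ := (h𝔖 x).subset l hl _ hx
        exact (Set.mem_Iio.1 hy).ne (Subtype.ext hyx)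
    · rintro (_ | ⟨x, l⟩) t h
      · exact nil
      · rw [List.cons_append, cons] at h
        rw [cons]
        exact h.imp fun hx => (h𝔖 _).init_mem l t
    · rintro (_ | ⟨x, l⟩) s t h
      · obtain ⟨-, ht, -⟩ := (pair s t).1 h
        exact (single t).2 ht
      · rw [List.cons_append, cons] at h ⊢
        exact h.imp fun hx => (h𝔖 _).skip_mem l s t
    · rintro (_ | ⟨x, l⟩) s t u h h'
      · obtain ⟨hs, ht, hst⟩ := (pair s t).1 h
        obtain ⟨_, hu, htu⟩ := (pair t u).1 h'
        exact (pair s u).2 ⟨hs, hu, htu.trans hst⟩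
      · rw [List.cons_append, cons] at h h' ⊢
        obtain ⟨hx, h⟩ := h
        obtain ⟨_, h'⟩ := h'
        exact ⟨hx, (h𝔖 _).trans l s t u h h'⟩
    · rintro (_ | ⟨x, l⟩) s t hl ht hs hts
      · have ht := (single t).1 ht
        have hs := (single s).1 hs
        have : (⟨t, ht⟩ : Z) ≠ ⟨s, hs⟩ := fun h => hts (Subtype.ext_iff.1 h)
        rcases lt_or_gt_of_ne this with h | h
        · exact Or.inr ((pair s t).2 ⟨hs, ht, h⟩)
        · exact Or.inl ((pair t s).2 ⟨ht, hs, h⟩)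
      · simp only [List.cons_append, cons] at ht hs ⊢
        obtain ⟨hx, ht⟩ := ht
        obtain ⟨_, hs⟩ := hs
        exact ((h𝔖 _).total l s t (by simpa using hl) ht hs hts).imp (⟨hx, ·⟩) (⟨hx, ·⟩)
    · rintro (_ | ⟨x, l⟩) hl
      · simp at hl
      · by_cases hx : x ∈ Z
        · refine ((h𝔖 ⟨x, hx⟩).finite l (by simpa using hl)).subset fun t ht => ?_
          exact ((cons _ _).1 ht).2
        · refine Set.finite_empty.subset fun t ht => hx ((cons _ _).1 ht).1

/-! ### Free sets and nested orders -/

theorem mk_toType_omega (n : ℕ) : #(ω_ (n : Ordinal.{0})).ToType = ℵ_ (n : Ordinal) := by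
  rw [mk_toType, Ordinal.card_omega]

theorem infinite_toType_omega (n : ℕ) : Infinite (ω_ (n : Ordinal.{0})).ToType := by
  rw [infinite_iff, mk_toType_omega]
  exact aleph0_le_aleph _

/-- The bijection `⋃ F → Y` may be taken to be the restriction of an injective map on all of `X`:
the elements outside `⋃ F` are sent outside a suitable finite set. -/
theorem FreeAt.exists_injective {X : Type*} [Fintype X] [DecidableEq X] {F : Finset (Finset X)}
    {n : ℕ} (h : FreeAt F n)
    (S : Finset (ω_ (n : Ordinal.{0})).ToType → Finset (ω_ (n : Ordinal.{0})).ToType) :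
    ∃ v : X → (ω_ (n : Ordinal.{0})).ToType, Function.Injective v ∧
      ∀ A ∈ F, ∀ x ∉ A, v x ∉ S (A.image v) := by
  classical
  obtain ⟨Y, u, hu, hS⟩ := h S
  have := infinite_toType_omega n
  let Q := Y ∪ F.biUnion fun A => S (A.image u)
  have : Infinite {y // y ∉ Q} := by
    have := Q.finite_toSet.infinite_compl
    exact this.to_subtype
  obtain ⟨e⟩ : Nonempty (X ↪ {y // y ∉ Q}) := by
    obtain ⟨f⟩ : Nonempty (X ↪ ℕ) := ⟨(Fintype.equivFin X).toEmbedding.trans Fin.valEmbedding⟩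
    exact ⟨f.trans (Infinite.natEmbedding _)⟩
  let U := F.sup id
  let v : X → (ω_ (n : Ordinal.{0})).ToType := fun x => if x ∈ U then u x else e x
  have hvU : ∀ x ∈ U, v x = u x := fun x hx => if_pos hx
  have hvU' : ∀ x ∉ U, v x = e x := fun x hx => if_neg hx
  have huY : ∀ x ∈ U, u x ∈ Y := fun x hx => hu.mapsTo hx
  have heY : ∀ x, (e x).1 ∉ Y := fun x hx => (e x).2 (Finset.mem_union_left _ hx)
  refine ⟨v, fun x y hxy => ?_, fun A hA x hx hxS => ?_⟩
  · by_cases hx : x ∈ U <;> by_cases hy : y ∈ U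
    · rw [hvU x hx, hvU y hy] at hxy
      exact hu.injOn hx hy hxy
    · rw [hvU x hx, hvU' y hy] at hxy
      exact absurd (hxy ▸ huY x hx) (heY y)
    · rw [hvU' x hx, hvU y hy] at hxy
      exact absurd (hxy ▸ huY y hy) (heY x)
    · rw [hvU' x hx, hvU' y hy] at hxy
      exact e.injective (Subtype.ext hxy)
  · have hAU : A ⊆ U := Finset.le_sup (f := id) hA
    have himg : A.image v = A.image u := Finset.image_congr fun y hy => hvU y (hAU hy)
    rw [himg] at hxS
    by_cases hxU : x ∈ U
    · rw [hvU x hxU] at hxS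
      have := hS A hA (Finset.mem_inter.2 ⟨hxS, huY x hxU⟩)
      obtain ⟨y, hy, hyx⟩ := Finset.mem_image.1 this
      exact hx (hu.injOn (hAU hy) hxU hyx ▸ hy)
    · rw [hvU' x hxU] at hxS
      exact (e x).2 (Finset.mem_union_right _ (Finset.mem_biUnion.2 ⟨A, hA, hxS⟩))

/-- To verify `FreeAt F n` only monotone and extensive set mappings have to be considered. -/
theorem freeAt_of_forall_monotone {X : Type*} [DecidableEq X] {F : Finset (Finset X)} {n : ℕ}
    (h : ∀ S : Finset (ω_ (n : Ordinal.{0})).ToType → Finset (ω_ (n : Ordinal.{0})).ToType,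
      Monotone S → (∀ s, s ⊆ S s) →
      ∃ v : X → (ω_ (n : Ordinal.{0})).ToType, Function.Injective v ∧
        ∀ A ∈ F, ∀ x ∉ A, v x ∉ S (A.image v)) : FreeAt F n := by
  intro S
  classical
  obtain ⟨v, hv, hS⟩ := h (fun s => s ∪ s.powerset.biUnion S)
    (fun s t hst => Finset.union_subset_union hst
      (Finset.biUnion_subset_biUnion_of_subset_left _ (Finset.powerset_mono.2 hst)))
    (fun s => Finset.subset_union_left)
  refine ⟨(F.sup id).image v, v, ?_, fun A hA y hy => ?_⟩
  · rw [Finset.coe_image]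
    exact hv.injOn.bijOn_image
  · obtain ⟨hyS, hyY⟩ := Finset.mem_inter.1 hy
    obtain ⟨x, -, rfl⟩ := Finset.mem_image.1 hyY
    by_contra hx
    refine hS A hA x (fun hxA => hx (Finset.mem_image_of_mem v hxA))
      (Finset.mem_union_right _ (Finset.mem_biUnion.2 ⟨_, Finset.mem_powerset_self _, ?_⟩))
    convert hyS

/-- Nested orders on `ωₙ` whose last orders have finite initial segments define a set mapping; a
free copy of `F` for this mapping pulls the nested orders back to `X`. -/
theorem FreeAt.nestedAt {X : Type*} [Fintype X] [DecidableEq X] {F : Finset (Finset X)} {n : ℕ}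
    (h : FreeAt F n) : NestedAt F n := by
  classical
  obtain ⟨𝔖, h𝔖⟩ := exists_isNestedOrdersOn (n + 1)
    (Set.univ : Set (ω_ (n : Ordinal.{0})).ToType) (by
      rw [mk_univ, mk_toType_omega, aleph_lt_aleph]
      exact_mod_cast n.lt_succ_self)
  have hfin : ∀ s : Finset (ω_ (n : Ordinal.{0})).ToType,
      {t | ∃ l : List _, l.length = n + 1 ∧ (∀ x ∈ l, x ∈ s) ∧ l ++ [t] ∈ 𝔖}.Finite := by
    intro s
    have hL : {l : List (ω_ (n : Ordinal.{0})).ToType |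
        l.length = n + 1 ∧ ∀ x ∈ l, x ∈ s}.Finite := by
      refine ((List.finite_length_eq s (n + 1)).image (List.map Subtype.val)).subset ?_
      rintro l ⟨hl, hls⟩
      exact ⟨l.attach.map fun x => ⟨x.1, hls x.1 x.2⟩, by simp [hl], by simp⟩
    refine (hL.biUnion fun l hl => h𝔖.finite l hl.1).subset ?_
    rintro t ⟨l, hl, hls, ht⟩
    exact Set.mem_biUnion (x := l) ⟨hl, hls⟩ ht
  obtain ⟨v, hv, hF⟩ := h.exists_injective fun s => (hfin s).toFinset
  refine ⟨{l | l.map v ∈ 𝔖}, ⟨?_, ?_, ?_, ?_, ?_, ?_, ?_⟩, ?_⟩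
  · intro l hl
    simpa using h𝔖.length_le _ hl
  · intro t
    exact (h𝔖.singleton_mem (v t)).2 trivial
  · intro l hl
    exact (h𝔖.nodup _ hl).of_map
  · intro l t hl
    simp only [Set.mem_ofPred_eq, List.map_append] at hl
    exact h𝔖.init_mem _ _ hl
  · intro l s t hl
    simp only [Set.mem_ofPred_eq, List.map_append] at hl ⊢
    exact h𝔖.skip_mem _ _ _ hl
  · intro l s t u hl hl'
    simp only [Set.mem_ofPred_eq, List.map_append] at hl hl' ⊢
    exact h𝔖.trans _ _ _ _ hl hl'
  · intro l s t hl ht hs hts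
    simp only [Set.mem_ofPred_eq, List.map_append] at ht hs ⊢
    exact h𝔖.total _ _ _ (by simpa using Nat.lt_succ_of_le hl) ht hs (hv.ne hts)
  · intro A hA l t hl ht hlA
    by_contra htA
    refine hF A hA t htA ?_
    rw [Set.Finite.mem_toFinset]
    refine ⟨l.map v, by simpa using hl, ?_, by simpa using ht⟩
    intro x hx
    obtain ⟨y, hy, rfl⟩ := List.mem_map.1 hx
    exact Finset.mem_image_of_mem v (hlA y hy)

/-! ### Closure rules of nested orders -/

/-- The family `F` obeys the closure rule `a, b → c`: every member containing `a` and `b` also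
contains `c`. The rule `a → c` is `HasRule F a a c`. -/
def HasRule {X : Type*} (F : Finset (Finset X)) (a b c : X) : Prop :=
  ∀ A ∈ F, a ∈ A → b ∈ A → c ∈ A

theorem HasRule.symm {X : Type*} {F : Finset (Finset X)} {a b c : X} (h : HasRule F a b c) :
    HasRule F b a c := fun A hA hb ha => h A hA ha hb

/-- The greatest element of `Z` in the linear order that the sequence `l` determines. -/
theorem IsNestedOrders.exists_top {X : Type*} [DecidableEq X] {n : ℕ} {𝔖 : Set (List X)}
    (h : IsNestedOrders n 𝔖) {l : List X} (hl : l.length ≤ n) (Z : Finset X) (hZ : Z.Nonempty)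
    (hlZ : ∀ z ∈ Z, l ++ [z] ∈ 𝔖) : ∃ m ∈ Z, ∀ z ∈ Z, z ≠ m → l ++ [m, z] ∈ 𝔖 := by
  induction hZ using Finset.Nonempty.cons_induction with
  | singleton a => exact ⟨a, by simp⟩
  | cons a Z ha hZ ih =>
    obtain ⟨m, hm, hmZ⟩ := ih fun z hz => hlZ z (Finset.mem_cons_of_mem hz)
    have ham : a ≠ m := fun e => ha (e ▸ hm)
    rcases h.total l m a hl (hlZ a (Finset.mem_cons_self a Z))
      (hlZ m (Finset.mem_cons_of_mem hm)) ham with h1 | h1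
    · refine ⟨a, Finset.mem_cons_self a Z, fun z hz hza => ?_⟩
      have hz := (Finset.mem_cons.1 hz).resolve_left hza
      by_cases hzm : z = m
      · exact hzm ▸ h1
      · exact h.trans l a m z h1 (hmZ z hz hzm)
    · refine ⟨m, Finset.mem_cons_of_mem hm, fun z hz hzm => ?_⟩
      rcases Finset.mem_cons.1 hz with rfl | hz
      · exact h1
      · exact hmZ z hz hzm

/-- `a, b, c, d` is a repetition-free enumeration of `X`. -/
structure IsEnum {X : Type*} (a b c d : X) : Prop where
  nodup : [a, b, c, d].Nodup
  mem : ∀ x, x = a ∨ x = b ∨ x = c ∨ x = d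

theorem IsEnum.subset_iff {X : Type*} {a b c d : X} (h : IsEnum a b c d) {A B : Finset X} :
    A ⊆ B ↔ (a ∈ A → a ∈ B) ∧ (b ∈ A → b ∈ B) ∧ (c ∈ A → c ∈ B) ∧ (d ∈ A → d ∈ B) := by
  refine ⟨fun hAB => ⟨@hAB a, @hAB b, @hAB c, @hAB d⟩, fun ⟨ha, hb, hc, hd⟩ x hx => ?_⟩
  rcases h.mem x with rfl | rfl | rfl | rfl
  · exact ha hx
  · exact hb hx
  · exact hc hx
  · exact hd hx

theorem isEnum_of_nodup {a b c d : Fin 4} (h : [a, b, c, d].Nodup) : IsEnum a b c d :=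
  ⟨h, by revert a b c d; decide⟩

/-- If every nonempty set that avoids `a` has a greatest element for the relation `p`, then repeated
choice of a greatest element lists the points other than `a` in descending order. -/
theorem exists_descending {a : Fin 4} {p : Fin 4 → Fin 4 → Prop}
    (hp : ∀ W : Finset (Fin 4), a ∉ W → W.Nonempty → ∃ m ∈ W, ∀ z ∈ W, z ≠ m → p m z) :
    ∃ b c d, [a, b, c, d].Nodup ∧ p b c ∧ p b d ∧ p c d := by
  have pick : ∀ W : Finset (Fin 4), a ∈ W → W.card ≤ 3 → ∃ m ∉ W, ∀ z ∉ W, z ≠ m → p m z := by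
    intro W haW hW
    obtain ⟨m, hm, hmW⟩ := hp Wᶜ (by simpa using haW)
      (Finset.card_pos.1 (by rw [Finset.card_compl, Fintype.card_fin]; omega))
    exact ⟨m, by simpa using hm, fun z hz => hmW z (by simpa using hz)⟩
  obtain ⟨b, hb, hbp⟩ := pick {a} (by simp) (by simp)
  obtain ⟨c, hc, hcp⟩ := pick {a, b} (by simp) (Finset.card_le_two.trans (by norm_num))
  obtain ⟨d, hd, -⟩ := pick {a, b, c} (by simp) Finset.card_le_three
  simp only [Finset.mem_insert, Finset.mem_singleton, not_or] at hb hc hd hbp hcp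
  exact ⟨b, c, d, by grind, hbp c hc.1 hc.2, hbp d hd.1 hd.2.1, hcp d ⟨hd.1, hd.2.1⟩ hd.2.2⟩

/-- If every nonempty set has a greatest element for the relation `p`, then repeated choice of a
greatest element lists the four points in descending order. -/
theorem exists_isEnum_descending {p : Fin 4 → Fin 4 → Prop}
    (hp : ∀ W : Finset (Fin 4), W.Nonempty → ∃ m ∈ W, ∀ z ∈ W, z ≠ m → p m z) :
    ∃ a b c d, IsEnum a b c d ∧ p a b ∧ p a c ∧ p a d ∧ p b c ∧ p b d ∧ p c d := by
  obtain ⟨a, -, ha⟩ := hp Finset.univ ⟨0, Finset.mem_univ 0⟩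
  obtain ⟨b, c, d, hn, h⟩ := exists_descending (a := a) (p := p) fun W _ => hp W
  have hn' : (b ≠ a ∧ c ≠ a ∧ d ≠ a) := by grind
  exact ⟨a, b, c, d, isEnum_of_nodup hn, ha b (Finset.mem_univ b) hn'.1,
    ha c (Finset.mem_univ c) hn'.2.1, ha d (Finset.mem_univ d) hn'.2.2, h⟩

theorem NestedAt.rules_zero {F : Finset (Finset (Fin 4))} (h : NestedAt F 0) :
    ∃ a b c d, IsEnum a b c d ∧ HasRule F a a b ∧ HasRule F a a c ∧ HasRule F a a d ∧
      HasRule F b b c ∧ HasRule F b b d ∧ HasRule F c c d := by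
  obtain ⟨𝔖, h𝔖, hF⟩ := h
  refine exists_isEnum_descending fun W hW => ?_
  obtain ⟨m, hm, hmW⟩ :=
    h𝔖.exists_top (l := []) (by simp) W hW fun z _ => h𝔖.singleton_mem z
  exact ⟨m, hm, fun z hz hzm A hA hmA _ =>
    hF A hA [m] z rfl (hmW z hz hzm) (by simpa using hmA)⟩

/-- The greatest point `a`, followed by the other points in the descending order that belongs
to `a`. -/
theorem IsNestedOrders.exists_isEnum {n : ℕ} {𝔖 : Set (List (Fin 4))} (h : IsNestedOrders n 𝔖)
    (hn : 1 ≤ n) :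
    ∃ a b c d, IsEnum a b c d ∧ [a, b, c] ∈ 𝔖 ∧ [a, b, d] ∈ 𝔖 ∧ [a, c, d] ∈ 𝔖 := by
  obtain ⟨a, -, ha⟩ := h.exists_top (l := []) (by simp) Finset.univ ⟨0, Finset.mem_univ 0⟩
    fun z _ => h.singleton_mem z
  obtain ⟨b, c, d, hnd, hbcd⟩ := exists_descending (a := a) (p := fun y z => [a] ++ [y, z] ∈ 𝔖)
    fun W hWa hW => h.exists_top (l := [a]) (by simpa using hn) W hW fun z hz =>
      ha z (Finset.mem_univ z) fun hza => hWa (hza ▸ hz)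
  exact ⟨a, b, c, d, isEnum_of_nodup hnd, hbcd⟩

/-- The first three rules come from the order that belongs to the greatest point `a`, the last from
the order that belongs to the greatest of the others. -/
theorem NestedAt.rules_one {F : Finset (Finset (Fin 4))} (h : NestedAt F 1) :
    ∃ a b c d, IsEnum a b c d ∧ HasRule F a b c ∧ HasRule F a b d ∧ HasRule F a c d ∧
      (HasRule F b c d ∨ HasRule F b d c ∨ HasRule F c d b) := by
  obtain ⟨𝔖, h𝔖, hF⟩ := h
  have rule : ∀ x y z, [x, y, z] ∈ 𝔖 → HasRule F x y z := fun x y z hxy A hA hx hy =>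
    hF A hA [x, y] z rfl hxy (by simp [hx, hy])
  obtain ⟨a, b, c, d, he, habc, habd, hacd⟩ := h𝔖.exists_isEnum le_rfl
  refine ⟨a, b, c, d, he, rule _ _ _ habc, rule _ _ _ habd, rule _ _ _ hacd, ?_⟩
  have hne : b ≠ c ∧ b ≠ d ∧ c ≠ d := by
    have := he.nodup
    grind
  -- the greatest of the three remaining points orders the other two
  obtain ⟨q, hq, hqZ⟩ := h𝔖.exists_top (l := []) (by simp) {b, c, d} ⟨b, by simp⟩
    fun z _ => h𝔖.singleton_mem z
  have hqZ : ∀ z ∈ ({b, c, d} : Finset (Fin 4)), z ≠ q → [q, z] ∈ 𝔖 := hqZ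
  have total : ∀ x y, [q, x] ∈ 𝔖 → [q, y] ∈ 𝔖 → x ≠ y → HasRule F q x y ∨ HasRule F q y x :=
    fun x y hx hy hxy => (h𝔖.total [q] y x (by simp) hx hy hxy).imp (rule _ _ _) (rule _ _ _)
  simp only [Finset.mem_insert, Finset.mem_singleton] at hq
  rcases hq with rfl | rfl | rfl
  · rcases total c d (hqZ c (by simp) hne.1.symm) (hqZ d (by simp) hne.2.1.symm) hne.2.2 with h | h
    · exact Or.inl h
    · exact Or.inr (Or.inl h)
  · rcases total b d (hqZ b (by simp) hne.1) (hqZ d (by simp) hne.2.2.symm) hne.2.1 with h | h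
    · exact Or.inl h.symm
    · exact Or.inr (Or.inr h)
  · rcases total b c (hqZ b (by simp) hne.2.1) (hqZ c (by simp) hne.2.2) hne.1 with h | h
    · exact Or.inr (Or.inl h.symm)
    · exact Or.inr (Or.inr h.symm)

theorem NestedAt.rule_two {F : Finset (Finset (Fin 4))} (h : NestedAt F 2) :
    ∃ a b c d, IsEnum a b c d ∧ ∀ A ∈ F, a ∈ A → b ∈ A → c ∈ A → d ∈ A := by
  obtain ⟨𝔖, h𝔖, hF⟩ := h
  obtain ⟨a, b, c, d, he, habc, habd, -⟩ := h𝔖.exists_isEnum one_le_two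
  have hnd := he.nodup
  rcases h𝔖.total [a, b] d c (by simp) habc habd (by grind) with h | h
  · exact ⟨a, b, c, d, he, fun A hA hxa hxb hxc =>
      hF A hA [a, b, c] d rfl h (by simp [hxa, hxb, hxc])⟩
  · exact ⟨a, b, d, c, isEnum_of_nodup (by grind), fun A hA hxa hxb hxc =>
      hF A hA [a, b, d] c rfl h (by simp [hxa, hxb, hxc])⟩

/-! ### Families obeying rules are free -/

theorem IsEnum.exists_map {X K : Type*} [DecidableEq X] {a b c d : X} (h : IsEnum a b c d)
    {a' b' c' d' : K} (h' : [a', b', c', d'].Nodup) :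
    ∃ v : X → K, Function.Injective v ∧ v a = a' ∧ v b = b' ∧ v c = c' ∧ v d = d' := by
  have hn := h.nodup
  refine ⟨fun x => if x = a then a' else if x = b then b' else if x = c then c' else d',
    fun x y hxy => ?_, ?_⟩
  · have hx := h.mem x
    have hy := h.mem y
    grind
  · grind

/-- For a monotone set mapping it suffices to consider a set `B` containing `A`, usually the largest
set avoiding a given point that obeys the rules. -/
theorem notMem_image_of_subset {X K : Type*} [DecidableEq K] {S : Finset K → Finset K}
    (hS : Monotone S) {v : X → K} {A : Finset X} (B : Finset X) (hAB : A ⊆ B) {y : K}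
    (h : y ∉ S (B.image v)) : y ∉ S (A.image v) :=
  fun hy => h (hS (Finset.image_subset_image hAB) hy)

theorem freeAt_zero {X : Type*} [DecidableEq X] {F : Finset (Finset X)} {a b c d : X}
    (he : IsEnum a b c d) (hab : HasRule F a a b) (hac : HasRule F a a c) (had : HasRule F a a d)
    (hbc : HasRule F b b c) (hbd : HasRule F b b d) (hcd : HasRule F c c d) : FreeAt F 0 := by
  refine freeAt_of_forall_monotone fun S hS hS' => ?_
  have := infinite_toType_omega 0
  obtain ⟨d', hd⟩ := Infinite.exists_notMem_finset (S ∅)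
  obtain ⟨c', hc⟩ := Infinite.exists_notMem_finset (S {d'})
  obtain ⟨b', hb⟩ := Infinite.exists_notMem_finset (S {c', d'})
  obtain ⟨a', ha⟩ := Infinite.exists_notMem_finset (S {b', c', d'})
  have ha0 := mt (@hS' _ a') ha
  have hb0 := mt (@hS' _ b') hb
  have hc0 := mt (@hS' _ c') hc
  simp only [Finset.mem_insert, Finset.mem_singleton, not_or] at ha0 hb0 hc0
  obtain ⟨v, hv, rfl, rfl, rfl, rfl⟩ := he.exists_map (a' := a') (b' := b') (c' := c') (d' := d')
    (by simp [ha0, hb0, hc0])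
  refine ⟨v, hv, fun A hA x hx => ?_⟩
  have hab := hab A hA
  have hac := hac A hA
  have had := had A hA
  have hbc := hbc A hA
  have hbd := hbd A hA
  have hcd := hcd A hA
  rcases he.mem x with h | h | h | h <;> subst x
  · exact notMem_image_of_subset hS {b, c, d} (he.subset_iff.2 (by simp [hx])) (by simpa using ha)
  · have h1 : a ∉ A := fun h => hx (hab h h)
    exact notMem_image_of_subset hS {c, d} (he.subset_iff.2 (by simp [hx, h1])) (by simpa using hb)
  · have h1 : a ∉ A := fun h => hx (hac h h)
    have h2 : b ∉ A := fun h => hx (hbc h h)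
    exact notMem_image_of_subset hS {d} (he.subset_iff.2 (by simp [hx, h1, h2])) (by simpa using hc)
  · have h1 : a ∉ A := fun h => hx (had h h)
    have h2 : b ∉ A := fun h => hx (hbd h h)
    have h3 : c ∉ A := fun h => hx (hcd h h)
    exact notMem_image_of_subset hS ∅ (he.subset_iff.2 (by simp [hx, h1, h2, h3]))
      (by simpa using hd)

/-- The last rule decides how the free points are found: for `b, c → d` by iterated pigeonhole
arguments, for the other two from countable closed sets, with `b` and `c` in exchanged roles. -/
theorem freeAt_one {X : Type*} [DecidableEq X] {F : Finset (Finset X)} {a b c d : X}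
    (he : IsEnum a b c d) (habc : HasRule F a b c) (habd : HasRule F a b d)
    (hacd : HasRule F a c d)
    (h : HasRule F b c d ∨ HasRule F b d c ∨ HasRule F c d b) : FreeAt F 1 := by
  refine freeAt_of_forall_monotone fun S hS hS' => ?_
  have hK : Uncountable (ω_ ((1 : ℕ) : Ordinal.{0})).ToType := by
    rw [← aleph0_lt_mk_iff, mk_toType_omega]
    simp
  rcases h with hbcd | h
  · obtain ⟨a', b', c', d', h1, h2, h3, h4, h5, h6, h7⟩ := exists_free_of_pigeonhole S hK
    have h3' := mt (@hS' _ _) h3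
    have h6' := mt (@hS' _ _) h6
    have h7' := mt (@hS' _ _) h7
    simp only [Finset.mem_insert, Finset.mem_singleton, not_or] at h3' h6' h7'
    obtain ⟨v, hv, rfl, rfl, rfl, rfl⟩ := he.exists_map (a' := a') (b' := b') (c' := c')
      (d' := d') (by simp [h7', h6', Ne.symm h3'])
    refine ⟨v, hv, fun A hA x hx => ?_⟩
    have habc := habc A hA
    have habd := habd A hA
    have hacd := hacd A hA
    have hbcd := hbcd A hA
    rcases he.mem x with h | h | h | h <;> subst x
    · exact notMem_image_of_subset hS {b, c, d} (he.subset_iff.2 (by simp [hx]))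
        (by simpa using h7)
    · exact notMem_image_of_subset hS {a, c, d} (he.subset_iff.2 (by simp [hx]))
        (by simpa using h6)
    · by_cases haA : a ∈ A
      · have hbA : b ∉ A := fun h => hx (habc haA h)
        exact notMem_image_of_subset hS {a, d} (he.subset_iff.2 (by simp [hx, hbA]))
          (by simpa using h4)
      · exact notMem_image_of_subset hS {b, d} (he.subset_iff.2 (by simp [hx, haA]))
          (by simpa using h5)
    · by_cases haA : a ∈ A
      · have hbA : b ∉ A := fun h => hx (habd haA h)
        have hcA : c ∉ A := fun h => hx (hacd haA h)
        exact notMem_image_of_subset hS {a} (he.subset_iff.2 (by simp [hx, hbA, hcA]))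
          (by simpa using h1)
      by_cases hbA : b ∈ A
      · have hcA : c ∉ A := fun h => hx (hbcd hbA h)
        exact notMem_image_of_subset hS {b} (he.subset_iff.2 (by simp [hx, haA, hcA]))
          (by simpa using h2)
      · exact notMem_image_of_subset hS {c} (he.subset_iff.2 (by simp [hx, haA, hbA]))
          (by simpa using h3)
  · obtain ⟨a', d', x', y', h1, h2, h3, h4, h5, h6⟩ := exists_free_of_closure S hK
    have h2' := mt (@hS' _ _) h2
    have h5' := mt (@hS' _ _) h5
    have h6' := mt (@hS' _ _) h6
    simp only [Finset.mem_insert, Finset.mem_singleton, not_or] at h2' h5' h6'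
    rcases h with hbdc | hcdb
    · obtain ⟨v, hv, rfl, rfl, rfl, rfl⟩ := he.exists_map (a' := a') (b' := y') (c' := x')
        (d' := d') (by simp [h6', h2', Ne.symm h5'.1])
      refine ⟨v, hv, fun A hA x hx => ?_⟩
      have habc := habc A hA
      have habd := habd A hA
      have hacd := hacd A hA
      have hbdc := hbdc A hA
      rcases he.mem x with h | h | h | h <;> subst x
      · exact notMem_image_of_subset hS {c, b, d} (he.subset_iff.2 (by simp [hx]))
          (by simpa using h6)
      · exact notMem_image_of_subset hS {a, c, d} (he.subset_iff.2 (by simp [hx]))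
          (by simpa using h2)
      · by_cases hbA : b ∈ A
        · have haA : a ∉ A := fun h => hx (habc h hbA)
          have hdA : d ∉ A := fun h => hx (hbdc hbA h)
          exact notMem_image_of_subset hS {b} (he.subset_iff.2 (by simp [hx, haA, hdA]))
            (by simpa using h3)
        · exact notMem_image_of_subset hS {a, d} (he.subset_iff.2 (by simp [hx, hbA]))
            (by simpa using h1)
      · by_cases haA : a ∈ A
        · have hbA : b ∉ A := fun h => hx (habd haA h)
          have hcA : c ∉ A := fun h => hx (hacd haA h)
          exact notMem_image_of_subset hS {a} (he.subset_iff.2 (by simp [hx, hbA, hcA]))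
            (by simpa using h4)
        · exact notMem_image_of_subset hS {c, b} (he.subset_iff.2 (by simp [hx, haA]))
            (by simpa using h5)
    · obtain ⟨v, hv, rfl, rfl, rfl, rfl⟩ := he.exists_map (a' := a') (b' := x') (c' := y')
        (d' := d') (by simp [h6', h2', Ne.symm h5'.1, Ne.symm h2'.2.1])
      refine ⟨v, hv, fun A hA x hx => ?_⟩
      have habc := habc A hA
      have habd := habd A hA
      have hacd := hacd A hA
      have hcdb := hcdb A hA
      rcases he.mem x with h | h | h | h <;> subst x
      · exact notMem_image_of_subset hS {b, c, d} (he.subset_iff.2 (by simp [hx]))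
          (by simpa using h6)
      · by_cases hcA : c ∈ A
        · have haA : a ∉ A := fun h => hx (hcdb hcA (hacd h hcA))
          have hdA : d ∉ A := fun h => hx (hcdb hcA h)
          exact notMem_image_of_subset hS {c} (he.subset_iff.2 (by simp [hx, haA, hdA]))
            (by simpa using h3)
        · exact notMem_image_of_subset hS {a, d} (he.subset_iff.2 (by simp [hx, hcA]))
            (by simpa using h1)
      · exact notMem_image_of_subset hS {a, b, d} (he.subset_iff.2 (by simp [hx]))
          (by simpa using h2)
      · by_cases haA : a ∈ A
        · have hbA : b ∉ A := fun h => hx (habd haA h)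
          have hcA : c ∉ A := fun h => hx (hacd haA h)
          exact notMem_image_of_subset hS {a} (he.subset_iff.2 (by simp [hx, hbA, hcA]))
            (by simpa using h4)
        · exact notMem_image_of_subset hS {b, c} (he.subset_iff.2 (by simp [hx, haA]))
            (by simpa using h5)

/-- The only set that may fail to be free is `{a, b, c}`, which is not a member of `F`. -/
theorem freeAt_two {X : Type*} [DecidableEq X] {F : Finset (Finset X)} {a b c d : X}
    (he : IsEnum a b c d) (habcd : ∀ A ∈ F, a ∈ A → b ∈ A → c ∈ A → d ∈ A) : FreeAt F 2 := by
  refine freeAt_of_forall_monotone fun S hS hS' => ?_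
  obtain ⟨a', b', c', d', h1, h2, h3, h4, h5, h6⟩ := exists_free_except_triple S
    (mk_toType_omega 2).ge
  have h4' := mt (@hS' _ _) h4
  have h5' := mt (@hS' _ _) h5
  have h6' := mt (@hS' _ _) h6
  simp only [Finset.mem_insert, Finset.mem_singleton, not_or] at h4' h5' h6'
  obtain ⟨v, hv, rfl, rfl, rfl, rfl⟩ := he.exists_map (a' := a') (b' := b') (c' := c')
    (d' := d') (by simp [h6', h5', h4'])
  refine ⟨v, hv, fun A hA x hx => ?_⟩
  rcases he.mem x with h | h | h | h <;> subst x
  · exact notMem_image_of_subset hS {b, c, d} (he.subset_iff.2 (by simp [hx])) (by simpa using h6)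
  · exact notMem_image_of_subset hS {a, c, d} (he.subset_iff.2 (by simp [hx])) (by simpa using h5)
  · exact notMem_image_of_subset hS {a, b, d} (he.subset_iff.2 (by simp [hx])) (by simpa using h4)
  · by_cases haA : a ∈ A
    · by_cases hbA : b ∈ A
      · have hcA : c ∉ A := fun h => hx (habcd A hA haA hbA h)
        exact notMem_image_of_subset hS {a, b} (he.subset_iff.2 (by simp [hx, hcA]))
          (by simpa using h1)
      · exact notMem_image_of_subset hS {a, c} (he.subset_iff.2 (by simp [hx, hbA]))
          (by simpa using h2)
    · exact notMem_image_of_subset hS {b, c} (he.subset_iff.2 (by simp [hx, haA]))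
        (by simpa using h3)

theorem freeAt_three {X : Type*} [DecidableEq X] {F : Finset (Finset X)} {a b c d : X}
    (he : IsEnum a b c d) : FreeAt F 3 := by
  refine freeAt_of_forall_monotone fun S hS hS' => ?_
  obtain ⟨a', b', c', d', h1, h2, h3, h4⟩ := exists_free_four S (mk_toType_omega 3).ge
  have h1' := mt (@hS' _ _) h1
  have h2' := mt (@hS' _ _) h2
  have h3' := mt (@hS' _ _) h3
  simp only [Finset.mem_insert, Finset.mem_singleton, not_or] at h1' h2' h3'
  obtain ⟨v, hv, rfl, rfl, rfl, rfl⟩ := he.exists_map (a' := a') (b' := b') (c' := c')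
    (d' := d') (by simp [h1', h2', h3'])
  refine ⟨v, hv, fun A _ x hx => ?_⟩
  rcases he.mem x with h | h | h | h <;> subst x
  · exact notMem_image_of_subset hS {b, c, d} (he.subset_iff.2 (by simp [hx])) (by simpa using h1)
  · exact notMem_image_of_subset hS {a, c, d} (he.subset_iff.2 (by simp [hx])) (by simpa using h2)
  · exact notMem_image_of_subset hS {a, b, d} (he.subset_iff.2 (by simp [hx])) (by simpa using h3)
  · exact notMem_image_of_subset hS {a, b, c} (he.subset_iff.2 (by simp [hx])) (by simpa using h4)

/-! ### Chains, cycles and intersections -/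

/-- The members of a linearly ordered family that contain `x` and those that contain `y` form two
final segments of the family, so the smaller of the two is contained in the other. -/
theorem LinearlyOrdered.hasRule {X : Type*} [DecidableEq X] {F : Finset (Finset X)}
    (h : LinearlyOrdered F) {x y : X} (hxy : (F.filter (x ∈ ·)).card ≤ (F.filter (y ∈ ·)).card) :
    HasRule F x x y := by
  intro A hA hx _
  by_contra hy
  refine hxy.not_gt (Finset.card_lt_card ((Finset.ssubset_iff_of_subset fun B hB => ?_).2
    ⟨A, by simp [hA, hx], by simp [hy]⟩))
  rw [Finset.mem_filter] at hB ⊢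
  refine ⟨hB.1, ?_⟩
  rcases h A hA B hB.1 with hAB | hBA
  · exact hAB hx
  · exact absurd (hBA hB.2) hy

theorem LinearlyOrdered.freeAt_zero {F : Finset (Finset (Fin 4))} (h : LinearlyOrdered F) :
    FreeAt F 0 := by
  obtain ⟨a, b, c, d, he, hab, hac, had, hbc, hbd, hcd⟩ :=
    exists_isEnum_descending (p := fun x y => HasRule F x x y) fun W hW => by
      obtain ⟨m, hm, hmin⟩ := W.exists_min_image (fun x => (F.filter (x ∈ ·)).card) hW
      exact ⟨m, hm, fun z hz _ => h.hasRule (hmin z hz)⟩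
  exact _root_.freeAt_zero he hab hac had hbc hbd hcd

theorem NestedAt.linearlyOrdered {F : Finset (Finset (Fin 4))} (h : NestedAt F 0) :
    LinearlyOrdered F := by
  obtain ⟨a, b, c, d, he, hab, hac, had, hbc, hbd, hcd⟩ := h.rules_zero
  intro A hA B hB
  rw [he.subset_iff, he.subset_iff]
  simp only [HasRule] at hab hac had hbc hbd hcd
  clear he
  grind

theorem nestedAt_zero_iff {F : Finset (Finset (Fin 4))} : NestedAt F 0 ↔ LinearlyOrdered F :=
  ⟨NestedAt.linearlyOrdered, fun h => h.freeAt_zero.nestedAt⟩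

theorem exists_mem_iff_of_cycle {X : Type*} [DecidableEq X] {F : Finset (Finset X)} {m : ℕ}
    {x : Fin (m + 3) → X} (hinj : Function.Injective x)
    (hx : ∀ i, {x i, x (i + 1)} ∈ restrictFamily F (Finset.univ.image x)) (i : Fin (m + 3)) :
    ∃ B ∈ F, ∀ j, x j ∈ B ↔ j = i ∨ j = i + 1 := by
  obtain ⟨B, hB, hBx⟩ := Finset.mem_image.1 (hx i)
  refine ⟨B, hB, fun j => ?_⟩
  have : x j ∈ B ∩ Finset.univ.image x ↔ x j ∈ B := by simp
  rw [← this, hBx, Finset.mem_insert, Finset.mem_singleton, hinj.eq_iff, hinj.eq_iff]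

/-- An edge of a cycle obeys no rule whose conclusion is another point of the cycle. -/
theorem eq_of_hasRule_of_cycle {X : Type*} [DecidableEq X] {F : Finset (Finset X)} {m : ℕ}
    {x : Fin (m + 3) → X} (hinj : Function.Injective x)
    (hx : ∀ i, {x i, x (i + 1)} ∈ restrictFamily F (Finset.univ.image x)) {i j : Fin (m + 3)}
    (h : HasRule F (x i) (x (i + 1)) (x j)) : j = i ∨ j = i + 1 := by
  obtain ⟨B, hB, hBx⟩ := exists_mem_iff_of_cycle hinj hx i
  exact (hBx j).1 (h B hB ((hBx i).2 (Or.inl rfl)) ((hBx _).2 (Or.inr rfl)))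

theorem NestedAt.not_containsCycle {F : Finset (Finset (Fin 4))} (h : NestedAt F 1) :
    ¬ ContainsCycle F := by
  obtain ⟨a, b, c, d, he, habc, habd, hacd, hbcd⟩ := h.rules_one
  rintro ⟨m, x, hinj, hx⟩
  have norule : ∀ i j, HasRule F (x i) (x (i + 1)) (x j) → j = i ∨ j = i + 1 :=
    fun i j => eq_of_hasRule_of_cycle hinj hx
  have hm : m ≤ 1 := by
    have := Fintype.card_le_of_injective x hinj
    simp only [Fintype.card_fin] at this
    omega
  have harith : ∀ i : Fin (m + 3), i - 1 + 1 = i ∧ i - 1 ≠ i ∧ i + 1 ≠ i ∧ i - 1 ≠ i + 1 := by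
    interval_cases m <;> decide
  have hnd := he.nodup
  by_cases ha : ∃ i, x i = a
  · -- no two points are joined to `a` by closed pairs
    obtain ⟨i, hi⟩ := ha
    obtain ⟨h1, h2, h3, h4⟩ := harith i
    have n1 : ¬ HasRule F a (x (i + 1)) (x (i - 1)) := fun h => by
      rcases norule i (i - 1) (by rwa [hi]) with h | h
      · exact h2 h
      · exact h4 h
    have n2 : ¬ HasRule F a (x (i - 1)) (x (i + 1)) := fun h => by
      rcases norule (i - 1) (i + 1) (by rw [h1, hi]; exact h.symm) with h | h
      · exact h4 h.symm
      · exact h3 (h.trans h1)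
    have e1 : x (i + 1) ≠ a := hi ▸ hinj.ne h3
    have e2 : x (i - 1) ≠ a := hi ▸ hinj.ne h2
    have e3 : x (i - 1) ≠ x (i + 1) := hinj.ne h4
    rcases he.mem (x (i + 1)) with h | h | h | h <;>
      rcases he.mem (x (i - 1)) with h' | h' | h' | h' <;> rw [h, h'] at n1 n2 <;> simp_all
  · push Not at ha
    have hbcd' : ∀ i, x i = b ∨ x i = c ∨ x i = d := fun i => (he.mem (x i)).resolve_left (ha i)
    have hm : m = 0 := by
      have := Finset.card_le_card (s := Finset.univ.image x) (t := {b, c, d}) fun y hy => by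
        obtain ⟨i, -, rfl⟩ := Finset.mem_image.1 hy
        simpa using hbcd' i
      rw [Finset.card_image_of_injective _ hinj, Finset.card_univ, Fintype.card_fin] at this
      have := this.trans Finset.card_le_three
      omega
    subst hm
    have n0 : ¬ HasRule F (x 0) (x 1) (x 2) := fun h => by
      have := norule 0 2 h
      revert this
      decide
    have n1 : ¬ HasRule F (x 1) (x 2) (x 0) := fun h => by
      have := norule 1 0 h
      revert this
      decide
    have n2 : ¬ HasRule F (x 2) (x 0) (x 1) := fun h => by
      have := norule 2 1 h
      revert this
      decide
    have e0 : x 0 ≠ x 1 := hinj.ne (by decide)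
    have e1 : x 1 ≠ x 2 := hinj.ne (by decide)
    have e2 : x 2 ≠ x 0 := hinj.ne (by decide)
    have symm : ∀ p q r, HasRule F p q r → HasRule F q p r := fun p q r => HasRule.symm
    rcases hbcd' 0 with h0 | h0 | h0 <;> rcases hbcd' 1 with h1 | h1 | h1 <;>
      rcases hbcd' 2 with h2 | h2 | h2 <;> rw [h0, h1] at e0 n0 n1 n2 <;> rw [h2] at n0 n1 n2 <;>
      grind

/-- Each triple obeys a rule, since otherwise it would be a cycle of length three. -/
theorem hasRule_of_not_containsCycle {X : Type*} [DecidableEq X] {F : Finset (Finset X)}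
    (h : ¬ ContainsCycle F) {p q r : X} (hn : [p, q, r].Nodup) :
    HasRule F p q r ∨ HasRule F q r p ∨ HasRule F r p q := by
  by_contra! hc
  simp only [HasRule, not_forall] at hc
  obtain ⟨⟨A, hA, hA1, hA2, hA3⟩, ⟨B, hB, hB1, hB2, hB3⟩, C, hC, hC1, hC2, hC3⟩ := hc
  refine h ⟨0, ![p, q, r], List.nodup_ofFn.1 (by simpa using hn), fun i => ?_⟩
  have himg : (Finset.univ.image ![p, q, r] : Finset X) = {p, q, r} := by
    ext; simp [Fin.exists_fin_succ, eq_comm]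
  rw [himg]
  fin_cases i
  · exact Finset.mem_image.2 ⟨A, hA, by ext; simp; grind⟩
  · exact Finset.mem_image.2 ⟨B, hB, by ext; simp; grind⟩
  · exact Finset.mem_image.2 ⟨C, hC, by ext; simp; grind⟩

/-- In a family closed under intersections, the intersection of the members containing a pair is a
member; if it is larger than the pair, the pair obeys a rule. -/
theorem InterClosed.exists_hasRule {F : Finset (Finset (Fin 4))} (hF : InterClosed F)
    {p q r s : Fin 4} (he : IsEnum p q r s) (h : {p, q} ∉ F) : HasRule F p q r ∨ HasRule F p q s := by
  by_contra! hc
  simp only [HasRule, not_forall] at hc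
  obtain ⟨⟨A, hA, hA1, hA2, hA3⟩, B, hB, hB1, hB2, hB3⟩ := hc
  refine h ?_
  have := hF {A, B} (by simp [Finset.insert_subset_iff, hA, hB])
  convert this
  simp only [Finset.inf_insert, Finset.inf_singleton, id]
  apply Finset.Subset.antisymm
  · simp [Finset.insert_subset_iff, hA1, hA2, hB1, hB2]
  · exact he.subset_iff.2 (by simp [hA3, hB3])

/-- Some edge of each cyclic arrangement of the four points obeys a rule, since otherwise all its
edges would be members of the family. -/
theorem hasRule_of_not_containsCycle_of_interClosed {F : Finset (Finset (Fin 4))}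
    (h : ¬ ContainsCycle F) (hF : InterClosed F) {p q r s : Fin 4} (hn : [p, q, r, s].Nodup) :
    (HasRule F p q r ∨ HasRule F p q s) ∨ (HasRule F q r s ∨ HasRule F q r p) ∨
      (HasRule F r s p ∨ HasRule F r s q) ∨ (HasRule F s p q ∨ HasRule F s p r) := by
  by_contra hc
  simp only [not_or] at hc
  have edge : ∀ {p q r s : Fin 4}, [p, q, r, s].Nodup → ¬ HasRule F p q r → ¬ HasRule F p q s →
      {p, q} ∈ F := fun hn h1 h2 => by
    by_contra hpq
    exact (hF.exists_hasRule (isEnum_of_nodup hn) hpq).elim h1 h2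
  refine h ⟨1, ![p, q, r, s], List.nodup_ofFn.1 (by simpa using hn), fun i => ?_⟩
  have himg : (Finset.univ.image ![p, q, r, s] : Finset (Fin 4)) = Finset.univ := by
    ext x
    have := (isEnum_of_nodup hn).mem x
    simpa [Fin.exists_fin_succ, eq_comm] using this
  rw [himg]
  fin_cases i
  · exact Finset.mem_image.2 ⟨{p, q}, edge hn hc.1.1 hc.1.2, by simp⟩
  · exact Finset.mem_image.2 ⟨{q, r}, edge (by grind) hc.2.1.1 hc.2.1.2, by simp⟩
  · exact Finset.mem_image.2 ⟨{r, s}, edge (by grind) hc.2.2.1.1 hc.2.2.1.2, by simp⟩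
  · exact Finset.mem_image.2 ⟨{s, p}, edge (by grind) hc.2.2.2.1 hc.2.2.2.2, by simp⟩

/-- A family closed under intersections without cycles obeys rules `a, b → c` and `a, c → d`.
Otherwise a single rule `a, b → c` would force, by the triples containing `d`, all the rules with
premises `a, b` and all those with premises `c, d`; then no other pair could obey a rule, and the
remaining four pairs would form a cycle. -/
theorem exists_hasRule_hasRule {F : Finset (Finset (Fin 4))}
    (h : ¬ ContainsCycle F) (hF : InterClosed F) :
    ∃ a b c d : Fin 4, [a, b, c, d].Nodup ∧ HasRule F a b c ∧ HasRule F a c d := by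
  by_contra! hno
  have key : ∀ a b c d : Fin 4, [a, b, c, d].Nodup → HasRule F a b c →
      HasRule F a b d ∧ HasRule F c d a ∧ HasRule F c d b := by
    intro a b c d hn habc
    have nacd := hno a b c d hn habc
    have nbcd := hno b a c d (by grind) habc.symm
    rcases hasRule_of_not_containsCycle h (p := a) (q := c) (r := d) (by grind) with h1 | h1 | h1
    · exact absurd h1 nacd
    · have nadb := hno d c a b (by grind) h1.symm
      have h2 : HasRule F c d b := by
        rcases hasRule_of_not_containsCycle h (p := b) (q := c) (r := d) (by grind)
          with h2 | h2 | h2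
        · exact absurd h2 nbcd
        · exact h2
        · exact absurd h1.symm (hno d b c a (by grind) h2)
      have nbda := hno d c b a (by grind) h2.symm
      refine ⟨?_, h1, h2⟩
      rcases hasRule_of_not_containsCycle h (p := a) (q := b) (r := d) (by grind) with h3 | h3 | h3
      · exact h3
      · exact absurd h3.symm nbda
      · exact absurd h3 nadb
    · exfalso
      have h2 : HasRule F d b c := by
        rcases hasRule_of_not_containsCycle h (p := b) (q := c) (r := d) (by grind)
          with h2 | h2 | h2
        · exact absurd h2 nbcd
        · exact absurd h2.symm (hno d a c b (by grind) h1)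
        · exact h2
      rcases hasRule_of_not_containsCycle h (p := a) (q := b) (r := d) (by grind) with h3 | h3 | h3
      · exact hno a b d c (by grind) h3 h1.symm
      · exact hno b d a c (by grind) h3 habc.symm
      · exact hno a d b c (by grind) h3.symm habc
  obtain ⟨a, b, c, d, hn, habc⟩ : ∃ a b c d : Fin 4, [a, b, c, d].Nodup ∧ HasRule F a b c := by
    rcases hasRule_of_not_containsCycle h (p := (0 : Fin 4)) (q := 1) (r := 2) (by decide)
      with h1 | h1 | h1
    · exact ⟨0, 1, 2, 3, by decide, h1⟩
    · exact ⟨1, 2, 0, 3, by decide, h1⟩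
    · exact ⟨2, 0, 1, 3, by decide, h1⟩
  obtain ⟨habd, hcda, hcdb⟩ := key a b c d hn habc
  rcases hasRule_of_not_containsCycle_of_interClosed h hF (p := a) (q := c) (r := b) (s := d)
    (by grind) with (h1 | h1) | (h1 | h1) | (h1 | h1) | (h1 | h1)
  · exact hno a c b d (by grind) h1 habd
  · exact hno a b c d hn habc h1
  · exact hno b a c d (by grind) habc.symm h1.symm
  · exact hno b c a d (by grind) h1.symm habd.symm
  · exact hno b d a c (by grind) h1 habc.symm
  · exact hno d b c a (by grind) h1.symm hcda.symm
  · exact hno d a c b (by grind) h1 hcdb.symm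
  · exact hno a d b c (by grind) h1.symm habc

theorem InterClosed.nestedAt_one_iff {F : Finset (Finset (Fin 4))} (hF : InterClosed F) :
    NestedAt F 1 ↔ ¬ ContainsCycle F := by
  refine ⟨NestedAt.not_containsCycle, fun h => FreeAt.nestedAt ?_⟩
  obtain ⟨a, b, c, d, hn, habc, hacd⟩ := exists_hasRule_hasRule h hF
  refine freeAt_one (isEnum_of_nodup hn) habc
    (fun A hA ha hb => hacd A hA ha (habc A hA ha hb)) hacd ?_
  rcases hasRule_of_not_containsCycle h (p := b) (q := c) (r := d) (by grind) with h1 | h1 | h1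
  · exact Or.inl h1
  · exact Or.inr (Or.inr h1)
  · exact Or.inr (Or.inl h1.symm)

theorem InterClosed.nestedAt_two_iff {F : Finset (Finset (Fin 4))} (hF : InterClosed F) :
    NestedAt F 2 ↔ F ≠ Finset.univ := by
  constructor
  · rintro h rfl
    obtain ⟨a, b, c, d, he, hr⟩ := h.rule_two
    have hnd := he.nodup
    have := hr {a, b, c} (Finset.mem_univ _) (by simp) (by simp) (by simp)
    grind
  · intro h
    -- some coatom is missing, since the coatoms generate all sets
    obtain ⟨d, hd⟩ : ∃ d : Fin 4, {d}ᶜ ∉ F := by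
      by_contra! hall
      refine h (Finset.eq_univ_of_forall fun B => ?_)
      have := hF (Bᶜ.image fun x => {x}ᶜ) fun C hC => by
        obtain ⟨x, -, rfl⟩ := Finset.mem_image.1 hC
        exact hall x
      convert this
      ext y
      simp only [Finset.inf_image, Finset.mem_inf, Finset.mem_compl, Function.comp, id,
        Finset.mem_singleton]
      grind
    obtain ⟨a, b, c, hn⟩ : ∃ a b c, [a, b, c, d].Nodup := by
      clear hd
      revert d
      decide
    refine (freeAt_two (isEnum_of_nodup hn) fun A hA ha hb hc => ?_).nestedAt
    by_contra hdA
    refine hd ?_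
    convert hA
    apply Finset.Subset.antisymm
    · exact (isEnum_of_nodup hn).subset_iff.2 (by simp [ha, hb, hc])
    · intro y hy
      simp only [Finset.mem_compl, Finset.mem_singleton]
      rintro rfl
      exact hdA hy

theorem LinearlyOrdered.not_containsCycle {X : Type*} [DecidableEq X] {F : Finset (Finset X)}
    (h : LinearlyOrdered F) : ¬ ContainsCycle F := by
  rintro ⟨m, x, hinj, hx⟩
  obtain ⟨A, hA, hAx⟩ := exists_mem_iff_of_cycle hinj hx 0
  obtain ⟨B, hB, hBx⟩ := exists_mem_iff_of_cycle hinj hx 1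
  rcases h A hA B hB with hAB | hBA
  · have := (hBx 0).1 (hAB ((hAx 0).2 (Or.inl rfl)))
    simp only [Fin.ext_iff, Fin.val_add] at this
    simp [Nat.mod_eq_of_lt (show 2 < m + 3 by omega)] at this
  · have := (hAx (1 + 1)).1 (hBA ((hBx (1 + 1)).2 (Or.inr rfl)))
    simp only [Fin.ext_iff, Fin.val_add] at this
    simp [Nat.mod_eq_of_lt (show 2 < m + 3 by omega)] at this

theorem containsCycle_univ : ContainsCycle (Finset.univ : Finset (Finset (Fin 4))) := by
  refine ⟨0, ![0, 1, 2], by decide, by decide⟩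

/-! ### Comparing the two indices -/

theorem freeAt_three_fin_four (F : Finset (Finset (Fin 4))) : FreeAt F 3 :=
  freeAt_three (isEnum_of_nodup (a := 0) (b := 1) (c := 2) (d := 3) (by decide))

theorem NestedAt.freeAt {F : Finset (Finset (Fin 4))} {n : ℕ} (h : NestedAt F n) (hn : n ≤ 3) :
    FreeAt F n := by
  interval_cases n
  · obtain ⟨a, b, c, d, he, hab, hac, had, hbc, hbd, hcd⟩ := h.rules_zero
    exact freeAt_zero he hab hac had hbc hbd hcd
  · obtain ⟨a, b, c, d, he, habc, habd, hacd, hr⟩ := h.rules_one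
    exact freeAt_one he habc habd hacd hr
  · obtain ⟨a, b, c, d, he, hr⟩ := h.rule_two
    exact freeAt_two he hr
  · exact freeAt_three_fin_four F

theorem theorem5p3 (F : Finset (Finset (Fin 4))) :
    IsLeast {n | FreeAt F n} (fr F) ∧ IsLeast {n | NestedAt F n} (no F) ∧
    fr F = no F ∧
    (InterClosed F →
      ((fr F = 0 ∧ no F = 0) ↔ LinearlyOrdered F) ∧
      ((fr F = 3 ∧ no F = 3) ↔ F = Finset.univ) ∧
      ((fr F = 2 ∧ no F = 2) ↔ (F ≠ Finset.univ ∧ ContainsCycle F)) ∧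
      ((fr F = 1 ∧ no F = 1) ↔
        (¬ LinearlyOrdered F ∧ F ≠ Finset.univ ∧ ¬ ContainsCycle F))) := by
  have hfr : IsLeast {n | FreeAt F n} (fr F) :=
    ⟨Nat.sInf_mem ⟨3, freeAt_three_fin_four F⟩, fun _ => Nat.sInf_le⟩
  have hno : IsLeast {n | NestedAt F n} (no F) :=
    ⟨Nat.sInf_mem ⟨3, (freeAt_three_fin_four F).nestedAt⟩, fun _ => Nat.sInf_le⟩
  have hno3 : no F ≤ 3 := hno.2 (freeAt_three_fin_four F).nestedAt
  have heq : fr F = no F :=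
    le_antisymm (hfr.2 (NestedAt.freeAt hno.1 hno3)) (hno.2 (FreeAt.nestedAt hfr.1))
  refine ⟨hfr, hno, heq, fun hF => ?_⟩
  rw [heq]
  simp only [and_self]
  have h0 : NestedAt F 0 ↔ LinearlyOrdered F := nestedAt_zero_iff
  have h1 := hF.nestedAt_one_iff
  have h2 := hF.nestedAt_two_iff
  have h01 : LinearlyOrdered F → ¬ ContainsCycle F := fun h => h.not_containsCycle
  have h12 : ¬ ContainsCycle F → F ≠ Finset.univ := fun h e => h (e ▸ containsCycle_univ)
  have hmem : NestedAt F (no F) := hno.1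
  have hle : ∀ k, NestedAt F k → no F ≤ k := fun k hk => hno.2 hk
  have l0 := hle 0
  have l1 := hle 1
  have l2 := hle 2
  rw [h0] at l0
  rw [h1] at l1
  rw [h2] at l2
  generalize no F = k at *
  interval_cases k
  · rw [h0] at hmem; simp; tauto
  · rw [h1] at hmem; simp at l0 ⊢; tauto
  · rw [h2] at hmem; simp at l0 l1 ⊢; tauto
  · simp at l0 l1 l2 ⊢; tauto
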